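/- Fix a set $Var$ of variables with at least two elements and a relational vocabulary (a set of predicate symbols with arities); $X,Y$ range over finite subsets of $Var$. The language $\mathsf{LUD}$ is given by $$\varphi ::= P\vec x \mid \neg\varphi \mid \varphi\wedge\varphi \mid D_X\varphi \mid D_XY \mid K_X\varphi \mid K_XY \mid U(X;Y),$$ and $\mathsf{LUD}^+$ is obtained from it by adding atoms $U_XY$. A metric dependence model consists of metric spaces $(\mathbb D_x,d_x)$ for $x\in Var$, an interpretation $I$ of each $n$-ary predicate symbol as an $n$-ary relation on $\bigcup_x\mathbb D_x$, a set $S$ of states, and surjections $\mathbf x:S\to\mathbb D_x$. Write $\mathbf X(s)=(\mathbf x(s))_{x\in X}$ and $\mathbb D_X=\mathbf X(S)\subseteq\prod_{x\in X}\mathbb D_x$, with the subspace topology of the product topology, metrized by the supremum metric. Let $d_X^S(s,t)=\sup_{x\in X}d_x(\mathbf x(s),\mathbf x(t))$ (with $\sup\emptyset=0$), and let the $X$-topology on $S$ be the weak topology induced by $\mathbf X$. Satisfaction at a state $s$ is defined as follows, with the usual Boolean clauses. - $s\models Px_1\dots x_n$ iff $(\mathbf x_1(s),\dots,\mathbf x_n(s))\in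 I(P)$. - $s\models D_X\varphi$ iff $w\models\varphi$ for all $w\in S$ with $\mathbf X(w)=\mathbf X(s)$. - $s\models D_XY$ iff $\mathbf Y(w)=\mathbf Y(s)$ for all $w\in S$ with $\mathbf X(w)=\mathbf X(s)$. - $s\models K_X\varphi$ iff $s$ lies in the interior of $\{w:w\models\varphi\}$ in the $X$-topology. - $s\models K_XY$ iff there are an $X$-open $O\ni s$ and a continuous $F:\mathbf X(O)\to\mathbb D_Y$ with $F\circ\mathbf X=\mathbf Y$ on $O$. - $s\models U(X;Y)$ iff $\forall\varepsilon>0\,\exists\delta>0\,\forall t,w\in S\,(d^S_X(t,w)<\delta\Rightarrow d^S_Y(t,w)<\varepsilon)$. - $s\models U_XY$ iff there is $\delta_0>0$ such that for all $\varepsilon>0$ there is $\delta>0$ such that all $t,w\in S$ with $d^S_X(s,t)<\delta_0$, $d^S_X(s,w)<\delta_0$ and $d^S_X(t,w)<\delta$ satisfy $d^S_Y(t,w)<\varepsilon$. **Proposition.** Local uniform dependence $U_XY$ is not expressible in $\mathsf{LUD}$: for all finite $X,Y\subseteq Var$ with $X\neq\emptyset$ and $Y\not\subseteq X$, there is no formula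 $\varphi$ of $\mathsf{LUD}$ such that $s\models\varphi\iff s\models U_XY$ holds in every metric dependence model at every state $s$. Hence $\mathsf{LUD}^+$ is strictly more expressive than $\mathsf{LUD}$ on metric dependence models: every formula of $\mathsf{LUD}$ is equivalent to a formula of $\mathsf{LUD}^+$, but some formula of $\mathsf{LUD}^+$ is not equivalent to any formula of $\mathsf{LUD}$ (equivalence meaning satisfaction at the same states of all metric dependence models). -/

import Mathlib

universe uVar uPred uVal uS

/-- A metric dependence model over a set `Var` of variables and a relational vocabulary `Pred`
with arity map `ar`: for each variable `x` a metric space `D x` (a set of values inside `Val`; the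
sets `D x` may overlap), an interpretation of each predicate symbol as a relation of the right arity
on the union of the `D x`, a set `S` of abstract states, and for each variable `x` a surjective map
`val x : S → D x`. -/
structure MetricDependenceModel (Var : Type uVar) (Pred : Type uPred) (ar : Pred → ℕ) where
  Val : Type uVal
  D : Var → Set Val
  metric : ∀ x, MetricSpace (D x)
  interp : (P : Pred) → Set (Fin (ar P) → (⋃ x, D x : Set Val))
  S : Type uS
  val : (x : Var) → S → D x
  val_surjective : ∀ x, Function.Surjective (val x)

attribute [instance] MetricDependenceModel.metric

namespace MetricDependenceModel

variable {Var : Type uVar} {Pred : Type uPred} {ar : Pred → ℕ}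

/-- The value tuple `X(s) = (x(s))_{x ∈ X}` of a finite set of variables, in `∏_{x ∈ X} D x`.
Mathlib's metric on this finite product is the Chebyshev (supremum) metric (identically `0` for
`X = ∅`), and its topology is the product topology. -/
def tuple (M : MetricDependenceModel.{uVar, uPred, uVal, uS} Var Pred ar) (X : Finset Var)
    (s : M.S) : (x : X) → M.D x.1 :=
  fun x => M.val x.1 s

/-- The range `D_X = {X(s) : s ∈ S}` of the joint variable `X`, a subspace of the product. -/
def jointRange (M : MetricDependenceModel.{uVar, uPred, uVal, uS} Var Pred ar) (X : Finset Var) :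
    Set ((x : X) → M.D x.1) :=
  Set.range (M.tuple X)

/-- The joint empirical variable `X : S → D_X`. -/
def joint (M : MetricDependenceModel.{uVar, uPred, uVal, uS} Var Pred ar) (X : Finset Var)
    (s : M.S) : M.jointRange X :=
  ⟨M.tuple X s, s, rfl⟩

/-- The `X`-topology on states: the weak topology induced by the joint variable `X`. -/
@[reducible] def stateTopology (M : MetricDependenceModel.{uVar, uPred, uVal, uS} Var Pred ar)
    (X : Finset Var) : TopologicalSpace M.S :=
  TopologicalSpace.induced (M.joint X) inferInstance

/-- The pseudo-distance `d_X^S(s, t) = d_X(X(s), X(t))` on states. -/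
noncomputable def stateDist (M : MetricDependenceModel.{uVar, uPred, uVal, uS} Var Pred ar)
    (X : Finset Var) (s t : M.S) : ℝ :=
  dist (M.joint X s) (M.joint X t)

/-- Truth of the atom `P x₁ … xₙ` at `s`. -/
def HoldsPred (M : MetricDependenceModel.{uVar, uPred, uVal, uS} Var Pred ar) (P : Pred)
    (xs : Fin (ar P) → Var) (s : M.S) : Prop :=
  (fun i => ⟨(M.val (xs i) s : M.Val),
    Set.mem_iUnion.2 ⟨xs i, (M.val (xs i) s).2⟩⟩) ∈ M.interp P

/-- Exact dependence `D_X Y` at `s`. -/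
def ExactDep (M : MetricDependenceModel.{uVar, uPred, uVal, uS} Var Pred ar) (X Y : Finset Var)
    (s : M.S) : Prop :=
  ∀ w : M.S, M.joint X s = M.joint X w → M.joint Y s = M.joint Y w

/-- Epistemic (locally continuous) dependence `K_X Y` at `s`: on some open `X`-neighbourhood `O`
of `s`, `Y` is a continuous function of `X`. -/
def EpistemicDep (M : MetricDependenceModel.{uVar, uPred, uVal, uS} Var Pred ar)
    (X Y : Finset Var) (s : M.S) : Prop :=
  ∃ O : Set M.S, @IsOpen M.S (M.stateTopology X) O ∧ s ∈ O ∧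
    ∃ F : (M.joint X '' O : Set (M.jointRange X)) → M.jointRange Y, Continuous F ∧
      ∀ t (ht : t ∈ O), F ⟨M.joint X t, Set.mem_image_of_mem _ ht⟩ = M.joint Y t

/-- Global uniform dependence `U(X;Y)`. -/
def UniformDep (M : MetricDependenceModel.{uVar, uPred, uVal, uS} Var Pred ar)
    (X Y : Finset Var) : Prop :=
  ∀ ε : ℝ, 0 < ε → ∃ δ : ℝ, 0 < δ ∧ ∀ s t : M.S,
    M.stateDist X s t < δ → M.stateDist Y s t < ε

/-- Local uniform dependence `U_X Y` at `s`. -/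
def LocalUniformDep (M : MetricDependenceModel.{uVar, uPred, uVal, uS} Var Pred ar)
    (X Y : Finset Var) (s : M.S) : Prop :=
  ∃ δ₀ : ℝ, 0 < δ₀ ∧ ∀ ε : ℝ, 0 < ε → ∃ δ : ℝ, 0 < δ ∧ ∀ t w : M.S,
    M.stateDist X s t < δ₀ → M.stateDist X s w < δ₀ →
      M.stateDist X t w < δ → M.stateDist Y t w < ε

end MetricDependenceModel

/-- Formulas of LUD: `P x₁ … xₙ`, `¬φ`, `φ ∧ ψ`, `D_X φ`, `D_X Y`, `K_X φ`, `K_X Y`, `U(X;Y)`. -/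
inductive LUD (Var : Type uVar) (Pred : Type uPred) (ar : Pred → ℕ) : Type (max uVar uPred) where
  | pred (P : Pred) (xs : Fin (ar P) → Var)
  | neg (φ : LUD Var Pred ar)
  | and (φ ψ : LUD Var Pred ar)
  | exactMod (X : Finset Var) (φ : LUD Var Pred ar)
  | exactDep (X Y : Finset Var)
  | knowMod (X : Finset Var) (φ : LUD Var Pred ar)
  | knowDep (X Y : Finset Var)
  | unifDep (X Y : Finset Var)

/-- Formulas of LUD⁺: those of LUD together with local uniform dependence atoms `U_X Y`. -/
inductive LUDPlus (Var : Type uVar) (Pred : Type uPred) (ar : Pred → ℕ) :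
    Type (max uVar uPred) where
  | pred (P : Pred) (xs : Fin (ar P) → Var)
  | neg (φ : LUDPlus Var Pred ar)
  | and (φ ψ : LUDPlus Var Pred ar)
  | exactMod (X : Finset Var) (φ : LUDPlus Var Pred ar)
  | exactDep (X Y : Finset Var)
  | knowMod (X : Finset Var) (φ : LUDPlus Var Pred ar)
  | knowDep (X Y : Finset Var)
  | unifDep (X Y : Finset Var)
  | localUnifDep (X Y : Finset Var)

/-- Satisfaction `M, s ⊨ φ` for LUD. -/
def LUD.Sat {Var : Type uVar} {Pred : Type uPred} {ar : Pred → ℕ}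
    (M : MetricDependenceModel.{uVar, uPred, uVal, uS} Var Pred ar) :
    LUD Var Pred ar → M.S → Prop
  | .pred P xs, s => M.HoldsPred P xs s
  | .neg φ, s => ¬ LUD.Sat M φ s
  | .and φ ψ, s => LUD.Sat M φ s ∧ LUD.Sat M ψ s
  | .exactMod X φ, s => ∀ w : M.S, M.joint X s = M.joint X w → LUD.Sat M φ w
  | .exactDep X Y, s => M.ExactDep X Y s
  | .knowMod X φ, s => s ∈ @interior M.S (M.stateTopology X) {w | LUD.Sat M φ w}
  | .knowDep X Y, s => M.EpistemicDep X Y s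
  | .unifDep X Y, _ => M.UniformDep X Y

/-- Satisfaction `M, s ⊨ φ` for LUD⁺. -/
def LUDPlus.Sat {Var : Type uVar} {Pred : Type uPred} {ar : Pred → ℕ}
    (M : MetricDependenceModel.{uVar, uPred, uVal, uS} Var Pred ar) :
    LUDPlus Var Pred ar → M.S → Prop
  | .pred P xs, s => M.HoldsPred P xs s
  | .neg φ, s => ¬ LUDPlus.Sat M φ s
  | .and φ ψ, s => LUDPlus.Sat M φ s ∧ LUDPlus.Sat M ψ s
  | .exactMod X φ, s => ∀ w : M.S, M.joint X s = M.joint X w → LUDPlus.Sat M φ w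
  | .exactDep X Y, s => M.ExactDep X Y s
  | .knowMod X φ, s => s ∈ @interior M.S (M.stateTopology X) {w | LUDPlus.Sat M φ w}
  | .knowDep X Y, s => M.EpistemicDep X Y s
  | .unifDep X Y, _ => M.UniformDep X Y
  | .localUnifDep X Y, s => M.LocalUniformDep X Y s

/-! Apart from the state-independent atom `U(X;Y)`, LUD sees only atomic facts, exact dependence and
topology, whereas `U_X Y` sees the metric near a state. It suffices to find one model in which all
states satisfy the same LUD formulas while `U_X Y` varies.

States are the points of `rippleDomain`; variables in `X` read off `p`, the others `(p, ripple p)`.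
Since `ripple` is continuous there, each variable is an embedding of the same space, so nonempty
sets of variables determine everything continuously; the empty set cannot separate states, and no
predicate holds. Hence LUD truth is constant (`sat_rippleModel_iff`). Yet `ripple` vanishes near
`(-1, 1)` and is not uniformly continuous on any neighbourhood of `(0, 0)`. Such a point requires a
domain that is not locally compact there, which is why most of the axis `p.2 = 0` is removed. -/

namespace MetricDependenceModel

/-! ### Models whose states LUD cannot distinguish -/

section General

variable {Var : Type uVar} {Pred : Type uPred} {ar : Pred → ℕ}
  (M : MetricDependenceModel.{uVar, uPred, uVal, uS} Var Pred ar)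

theorem stateDist_lt_iff {X : Finset Var} {s t : M.S} {δ : ℝ} (hδ : 0 < δ) :
    M.stateDist X s t < δ ↔ ∀ x ∈ X, dist (M.val x s) (M.val x t) < δ := by
  change dist (M.tuple X s) (M.tuple X t) < δ ↔ _
  rw [dist_pi_lt_iff hδ, Subtype.forall]
  rfl

theorem joint_eq_iff {X : Finset Var} {s t : M.S} :
    M.joint X s = M.joint X t ↔ ∀ x ∈ X, M.val x s = M.val x t := by
  rw [Subtype.ext_iff, funext_iff, Subtype.forall]
  rfl

theorem joint_empty (s t : M.S) : M.joint ∅ s = M.joint ∅ t := by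
  simp [joint_eq_iff]

theorem exactDep_empty (Y : Finset Var) (s t : M.S) (h : M.ExactDep ∅ Y s) :
    M.ExactDep ∅ Y t := fun w _ =>
  (h t (M.joint_empty s t)).symm.trans (h w (M.joint_empty s w))

/-- The empty joint variable is constant, so an open set of its topology that contains one state
contains all; the same `O` and `F` serve everywhere. -/
theorem epistemicDep_empty (Y : Finset Var) (s t : M.S) (h : M.EpistemicDep ∅ Y s) :
    M.EpistemicDep ∅ Y t := by
  obtain ⟨O, hO, hs, F⟩ := h
  refine ⟨O, hO, ?_, F⟩
  obtain ⟨T, -, rfl⟩ := isOpen_induced_iff.1 hO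
  rw [Set.mem_preimage] at hs ⊢
  rwa [M.joint_empty t s]

/-- If no predicate holds anywhere and the dependence atoms `D_X Y` and `K_X Y` do not depend on the
state, then no formula of LUD distinguishes two states. -/
theorem sat_iff_sat_of_homogeneous (hP : ∀ P, M.interp P = ∅)
    (hD : ∀ X Y s t, M.ExactDep X Y s → M.ExactDep X Y t)
    (hK : ∀ X Y s t, M.EpistemicDep X Y s → M.EpistemicDep X Y t)
    (φ : LUD Var Pred ar) : ∀ s t : M.S, LUD.Sat M φ s ↔ LUD.Sat M φ t := by
  induction φ with
  | pred P xs => intro s t; simp [LUD.Sat, HoldsPred, hP]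
  | neg φ ih => intro s t; simp only [LUD.Sat, ih s t]
  | and φ ψ ih₁ ih₂ => intro s t; simp only [LUD.Sat, ih₁ s t, ih₂ s t]
  | exactMod X φ ih =>
    intro s t
    -- Reflexivity gives `φ` at the base state, and the induction hypothesis carries it to every
    -- state.
    exact ⟨fun h w _ => (ih s w).1 (h s rfl), fun h w _ => (ih t w).1 (h t rfl)⟩
  | exactDep X Y => exact fun s t => ⟨hD X Y s t, hD X Y t s⟩
  | knowMod X φ ih =>
    have key : ∀ s t : M.S, LUD.Sat M (.knowMod X φ) s → LUD.Sat M (.knowMod X φ) t := by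
      intro s t h
      let := M.stateTopology X
      have hs : LUD.Sat M φ s := interior_subset h
      have : {w | LUD.Sat M φ w} = Set.univ := Set.eq_univ_of_forall fun w => (ih s w).1 hs
      simp only [LUD.Sat, this, interior_univ, Set.mem_univ]
    exact fun s t => ⟨key s t, key t s⟩
  | knowDep X Y => exact fun s t => ⟨hK X Y s t, hK X Y t s⟩
  | unifDep X Y => exact fun s t => Iff.rfl

/-- If all single variables are homeomorphisms onto their ranges for one topology on the states,
then every nonempty set of variables continuously determines every set of variables. -/
theorem epistemicDep_of_leftInverse [TopologicalSpace M.S] (hc : ∀ x, Continuous (M.val x))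
    (g : ∀ x, M.D x → M.S) (hg : ∀ x, Continuous (g x))
    (hgl : ∀ x, Function.LeftInverse (g x) (M.val x))
    {X : Finset Var} (hX : X.Nonempty) (Y : Finset Var) (s : M.S) : M.EpistemicDep X Y s := by
  obtain ⟨x, hx⟩ := hX
  have hY : Continuous (M.joint Y) :=
    Continuous.subtype_mk (continuous_pi fun y => hc y.1) _
  refine ⟨Set.univ, ⟨Set.univ, isOpen_univ, rfl⟩, Set.mem_univ s,
    fun τ => M.joint Y (g x (τ.1.1 ⟨x, hx⟩)), ?_, ?_⟩
  · exact hY.comp ((hg x).comp ((continuous_apply (⟨x, hx⟩ : X)).comp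
      (continuous_subtype_val.comp continuous_subtype_val)))
  · intro t _
    exact congrArg (M.joint Y) (hgl x t)

theorem exactDep_of_injective (hi : ∀ x, Function.Injective (M.val x))
    {X : Finset Var} (hX : X.Nonempty) (Y : Finset Var) (s : M.S) : M.ExactDep X Y s := by
  obtain ⟨x, hx⟩ := hX
  intro w h
  rw [hi x (M.joint_eq_iff.1 h x hx)]

end General

/-! ### A continuous function with no uniform neighbourhood at the origin -/

/-- A function on the plane vanishing for `p.1 ≤ 0`, whose oscillation near the axis `p.2 = 0` does
not decay along the lines `p.1 = a`, `0 < a`. -/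
noncomputable def ripple (p : ℝ × ℝ) : ℝ := max 0 p.1 * Real.sin p.2⁻¹

/-- The part of the plane consisting of the axis `p.1 = 0` and the complement of the axis
`p.2 = 0`. -/
def rippleDomain : Set (ℝ × ℝ) := {p | p.2 ≠ 0 ∨ p.1 = 0}

theorem ripple_of_nonpos {p : ℝ × ℝ} (hp : p.1 ≤ 0) : ripple p = 0 := by
  simp [ripple, max_eq_left hp]

/-- Away from `p.2 = 0` both factors are continuous. On `p.1 = 0`, origin included, the sine is
bounded and the other factor tends to `0`. -/
theorem continuousAt_ripple {p : ℝ × ℝ} (hp : p ∈ rippleDomain) : ContinuousAt ripple p := by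
  have hmax : Continuous fun q : ℝ × ℝ => max 0 q.1 := continuous_const.max continuous_fst
  rcases hp with hp | hp
  · exact hmax.continuousAt.mul
      (Real.continuous_sin.continuousAt.comp (continuousAt_snd.inv₀ hp))
  · have h0 : max 0 p.1 = 0 := by simp [hp]
    rw [ContinuousAt, ripple_of_nonpos hp.le]
    refine squeeze_zero_norm (fun q => ?_) (h0 ▸ hmax.tendsto p)
    rw [ripple, norm_mul, Real.norm_of_nonneg (le_max_left _ _)]
    exact mul_le_of_le_one_right (le_max_left _ _) (Real.abs_sin_le_one _)

theorem continuous_ripple_rippleDomain : Continuous fun p : rippleDomain => ripple p.1 :=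
  continuous_iff_continuousAt.2 fun p =>
    (continuousAt_ripple p.2).comp continuous_subtype_val.continuousAt

/-- Near the axis `p.2 = 0` the function `ripple` attains both extreme values on each line
`p.1 = a`. -/
theorem exists_ripple_eq {a δ : ℝ} (ha : 0 < a) (hδ : 0 < δ) :
    ∃ b c : ℝ, 0 < b ∧ b < δ ∧ 0 < c ∧ c < δ ∧ ripple (a, b) = a ∧ ripple (a, c) = -a := by
  obtain ⟨n, hn⟩ := exists_nat_gt δ⁻¹
  have hn0 : (0 : ℝ) ≤ n := n.cast_nonneg
  have hπ := Real.pi_gt_three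
  have h1 : δ⁻¹ < Real.pi / 2 + n * (2 * Real.pi) := by nlinarith
  have h2 : δ⁻¹ < Real.pi / 2 + n * (2 * Real.pi) + Real.pi := by nlinarith
  have hδ' : 0 < δ⁻¹ := inv_pos.2 hδ
  -- Reciprocals of phases at which the sine is `1` and `-1`; both phases exceed `δ⁻¹`.
  refine ⟨(Real.pi / 2 + n * (2 * Real.pi))⁻¹, (Real.pi / 2 + n * (2 * Real.pi) + Real.pi)⁻¹,
    inv_pos.2 (hδ'.trans h1), inv_lt_of_inv_lt₀ hδ h1, inv_pos.2 (hδ'.trans h2),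
    inv_lt_of_inv_lt₀ hδ h2, ?_, ?_⟩
  · simp [ripple, max_eq_right ha.le, Real.sin_add_nat_mul_two_pi]
  · simp [ripple, max_eq_right ha.le, Real.sin_add_pi, Real.sin_add_nat_mul_two_pi]

/-! ### The separating model -/

/-- The value `(p, 0)` or `(p, ripple p)` of a variable at the state `p`. -/
noncomputable def rippleValue (b : Prop) [Decidable b] (p : ULift.{uS} rippleDomain) :
    ULift.{uVal} ((ℝ × ℝ) × ℝ) :=
  ULift.up (p.down.1, if b then 0 else ripple p.down.1)

theorem continuous_rippleValue (b : Prop) [Decidable b] :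
    Continuous (rippleValue.{uVal, uS} b) := by
  refine continuous_uliftUp.comp (Continuous.prodMk
    (continuous_subtype_val.comp continuous_uliftDown) ?_)
  split_ifs
  · exact continuous_const
  · exact continuous_ripple_rippleDomain.comp continuous_uliftDown

/-- The model over `rippleDomain` in which the variables of `X` read off the point `p` of the plane
and all other variables read off the point `(p, ripple p)` of the graph. -/
noncomputable abbrev rippleModel {Var : Type uVar} {Pred : Type uPred} (ar : Pred → ℕ) [DecidableEq Var]
    (X : Finset Var) : MetricDependenceModel.{uVar, uPred, uVal, uS} Var Pred ar where
  Val := ULift.{uVal} ((ℝ × ℝ) × ℝ)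
  D x := Set.range (rippleValue.{uVal, uS} (x ∈ X))
  metric _ := inferInstance
  interp _ := ∅
  S := ULift.{uS} rippleDomain
  val x := Set.rangeFactorization (rippleValue (x ∈ X))
  val_surjective _ := Set.rangeFactorization_surjective

section RippleModel

variable {Var : Type uVar} {Pred : Type uPred} (ar : Pred → ℕ) [DecidableEq Var] (X : Finset Var)

/-- Recovers the state from the value of a single variable in `rippleModel`. -/
def rippleState (b : Prop) [Decidable b] (v : Set.range (rippleValue.{uVal, uS} b)) :
    ULift.{uS} rippleDomain :=
  ULift.up ⟨v.1.down.1, by obtain ⟨_, p, rfl⟩ := v; exact p.down.2⟩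

theorem continuous_rippleState (b : Prop) [Decidable b] :
    Continuous (rippleState.{uVal, uS} b) :=
  continuous_uliftUp.comp (Continuous.subtype_mk
    (continuous_fst.comp (continuous_uliftDown.comp continuous_subtype_val)) _)

theorem sat_rippleModel_iff (φ : LUD Var Pred ar)
    (s t : (rippleModel.{uVar, uPred, uVal, uS} ar X).S) :
    LUD.Sat _ φ s ↔ LUD.Sat _ φ t := by
  have hl : ∀ x, Function.LeftInverse (rippleState (x ∈ X))
    ((rippleModel.{uVar, uPred, uVal, uS} ar X).val x) := fun _ _ => rfl
  refine sat_iff_sat_of_homogeneous _ (fun _ => rfl) (fun X' Y s t h => ?_)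
    (fun X' Y s t h => ?_) φ s t
  -- A single variable of `X'` recovers the state; with no variable available, the atom is
  -- state-independent for trivial reasons.
  · rcases X'.eq_empty_or_nonempty with rfl | hX'
    · exact exactDep_empty _ Y s t h
    · exact exactDep_of_injective _ (fun x => (hl x).injective) hX' Y t
  · rcases X'.eq_empty_or_nonempty with rfl | hX'
    · exact epistemicDep_empty _ Y s t h
    · let : TopologicalSpace (rippleModel.{uVar, uPred, uVal, uS} ar X).S :=
        inferInstanceAs (TopologicalSpace (ULift.{uS} rippleDomain))
      exact epistemicDep_of_leftInverse _
        (fun x => (continuous_rippleValue (x ∈ X)).subtype_mk _)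
        (fun x => rippleState (x ∈ X)) (fun x => continuous_rippleState _) hl hX' Y t

theorem dist_val_rippleModel (x : Var) (s t : ULift.{uS} rippleDomain) :
    dist ((rippleModel.{uVar, uPred, uVal, uS} ar X).val x s)
      ((rippleModel.{uVar, uPred, uVal, uS} ar X).val x t) =
    max (dist s.down.1 t.down.1)
      (if x ∈ X then 0 else dist (ripple s.down.1) (ripple t.down.1)) := by
  change max (dist s.down.1 t.down.1) (dist (if x ∈ X then 0 else ripple s.down.1)
    (if x ∈ X then 0 else ripple t.down.1)) = _
  split_ifs <;> simp

variable {X}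

/-- Variables in `X` have second component `0`, so only the plane distance remains; for empty `X`
the distance would be identically `0`. -/
theorem stateDist_rippleModel_lt_iff (hX : X.Nonempty) (s t : ULift.{uS} rippleDomain) {δ : ℝ}
    (hδ : 0 < δ) : (rippleModel.{uVar, uPred, uVal, uS} ar X).stateDist X s t < δ ↔
      dist s.down.1 t.down.1 < δ := by
  rw [stateDist_lt_iff _ hδ]
  constructor
  · obtain ⟨x, hx⟩ := hX
    intro h
    have := h x hx
    rw [dist_val_rippleModel] at this
    exact (le_max_left _ _).trans_lt this
  · intro h x hx
    rw [dist_val_rippleModel, if_pos hx]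
    exact max_lt h hδ

/-- The unit ball about `(-1, 1)` lies in `p.1 < 0`, where `ripple` vanishes, so every variable
shows just the plane distance and `δ = ε` works. -/
theorem localUniformDep_rippleModel (hX : X.Nonempty) (Y : Finset Var) :
    (rippleModel.{uVar, uPred, uVal, uS} ar X).LocalUniformDep X Y
      (ULift.up ⟨(-1, 1), Or.inl one_ne_zero⟩) := by
  have hnonpos : ∀ p : ℝ × ℝ, dist ((-1, 1) : ℝ × ℝ) p < 1 → ripple p = 0 := by
    intro p hp
    have h1 : dist (-1 : ℝ) p.1 < 1 := (le_max_left _ _).trans_lt hp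
    rw [Real.dist_eq, abs_lt] at h1
    exact ripple_of_nonpos (by linarith)
  refine ⟨1, one_pos, fun ε hε => ⟨ε, hε, fun t w ht hw htw => ?_⟩⟩
  rw [stateDist_rippleModel_lt_iff _ hX _ _ one_pos] at ht hw
  rw [stateDist_rippleModel_lt_iff _ hX _ _ hε] at htw
  rw [stateDist_lt_iff _ hε]
  intro y _
  rw [dist_val_rippleModel, hnonpos _ ht, hnonpos _ hw]
  simpa [hε] using htw

theorem not_localUniformDep_rippleModel (hX : X.Nonempty) {Y : Finset Var} (hY : ¬ Y ⊆ X) :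
    ¬ (rippleModel.{uVar, uPred, uVal, uS} ar X).LocalUniformDep X Y
      (ULift.up ⟨(0, 0), Or.inr rfl⟩) := by
  rintro ⟨δ₀, hδ₀, h⟩
  obtain ⟨y, hyY, hyX⟩ := Finset.not_subset.1 hY
  -- On the line `p.1 = δ₀ / 2` the values `δ₀ / 2` and `-δ₀ / 2` are a distance `δ₀` apart,
  -- contradicting `ε = δ₀ / 2`. The bound `min δ δ₀` below keeps the two points close to each other
  -- and inside the ball.
  obtain ⟨δ, hδ, h⟩ := h (δ₀ / 2) (half_pos hδ₀)
  obtain ⟨b, c, hb, hbδ, hc, hcδ, hfb, hfc⟩ := exists_ripple_eq (half_pos hδ₀) (lt_min hδ hδ₀)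
  rw [lt_min_iff] at hbδ hcδ
  have hclose : ∀ d, 0 < d → d < δ₀ → dist ((0, 0) : ℝ × ℝ) (δ₀ / 2, d) < δ₀ := by
    intro d hd hdδ
    rw [Prod.dist_eq, max_lt_iff, Real.dist_eq, Real.dist_eq, abs_lt, abs_lt]
    exact ⟨⟨by simp only; linarith, by simp only; linarith⟩,
      ⟨by simp only; linarith, by simp only; linarith⟩⟩
  have key := h (ULift.up ⟨(δ₀ / 2, b), Or.inl hb.ne'⟩) (ULift.up ⟨(δ₀ / 2, c), Or.inl hc.ne'⟩)
    ((stateDist_rippleModel_lt_iff _ hX _ _ hδ₀).2 (hclose b hb hbδ.2))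
    ((stateDist_rippleModel_lt_iff _ hX _ _ hδ₀).2 (hclose c hc hcδ.2))
    ((stateDist_rippleModel_lt_iff _ hX _ _ hδ).2 (by
      rw [Prod.dist_eq, max_lt_iff, dist_self, Real.dist_eq, abs_lt]
      exact ⟨hδ, by simp only; linarith [hcδ.1], by simp only; linarith [hbδ.1]⟩))
  rw [stateDist_lt_iff _ (half_pos hδ₀)] at key
  have := key y hyY
  rw [dist_val_rippleModel, if_neg hyX] at this
  have := (le_max_right _ _).trans_lt this
  rw [hfb, hfc, Real.dist_eq, abs_lt] at this
  linarith [this.2]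

end RippleModel

end MetricDependenceModel

/-! ### Comparison of LUD and LUD⁺ -/

/-- The inclusion of LUD in LUD⁺. -/
def LUD.toPlus {Var : Type uVar} {Pred : Type uPred} {ar : Pred → ℕ} :
    LUD Var Pred ar → LUDPlus Var Pred ar
  | .pred P xs => .pred P xs
  | .neg φ => .neg φ.toPlus
  | .and φ ψ => .and φ.toPlus ψ.toPlus
  | .exactMod X φ => .exactMod X φ.toPlus
  | .exactDep X Y => .exactDep X Y
  | .knowMod X φ => .knowMod X φ.toPlus
  | .knowDep X Y => .knowDep X Y
  | .unifDep X Y => .unifDep X Y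

theorem LUD.sat_toPlus {Var : Type uVar} {Pred : Type uPred} {ar : Pred → ℕ}
    (M : MetricDependenceModel.{uVar, uPred, uVal, uS} Var Pred ar) (φ : LUD Var Pred ar) :
    LUDPlus.Sat M φ.toPlus = LUD.Sat M φ := by
  induction φ with
  | pred | exactDep | knowDep | unifDep => rfl
  | neg φ ih => funext s; simp only [toPlus, LUDPlus.Sat, LUD.Sat, ih]
  | and φ ψ ih₁ ih₂ => funext s; simp only [toPlus, LUDPlus.Sat, LUD.Sat, ih₁, ih₂]
  | exactMod X φ ih => funext s; simp only [toPlus, LUDPlus.Sat, LUD.Sat, ih]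
  | knowMod X φ ih => funext s; simp only [toPlus, LUDPlus.Sat, LUD.Sat, ih]

theorem LUD.not_exists_iff_localUniformDep {Var : Type uVar} {Pred : Type uPred} (ar : Pred → ℕ)
    {X Y : Finset Var} (hX : X.Nonempty) (hY : ¬ Y ⊆ X) :
    ¬ ∃ φ : LUD Var Pred ar,
      ∀ (M : MetricDependenceModel.{uVar, uPred, uVal, uS} Var Pred ar) (s : M.S),
        LUD.Sat M φ s ↔ M.LocalUniformDep X Y s := by
  classical
  rintro ⟨φ, hφ⟩
  refine MetricDependenceModel.not_localUniformDep_rippleModel.{uVar, uPred, uVal, uS} ar hX hY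
    ((hφ _ _).1 ((MetricDependenceModel.sat_rippleModel_iff ar X φ _ _).1
      ((hφ _ _).2 (MetricDependenceModel.localUniformDep_rippleModel ar hX Y))))

theorem mainTheorem4 {Var : Type uVar} [Nontrivial Var] {Pred : Type uPred} (ar : Pred → ℕ) :
    (∀ X Y : Finset Var, X.Nonempty → ¬ Y ⊆ X →
      ¬ ∃ φ : LUD Var Pred ar,
        ∀ (M : MetricDependenceModel.{uVar, uPred, uVal, uS} Var Pred ar) (s : M.S),
          LUD.Sat M φ s ↔ M.LocalUniformDep X Y s) ∧
    ((∀ φ : LUD Var Pred ar, ∃ ψ : LUDPlus Var Pred ar,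
        ∀ (M : MetricDependenceModel.{uVar, uPred, uVal, uS} Var Pred ar) (s : M.S),
          LUDPlus.Sat M ψ s ↔ LUD.Sat M φ s) ∧
     (∃ ψ : LUDPlus Var Pred ar, ¬ ∃ φ : LUD Var Pred ar,
        ∀ (M : MetricDependenceModel.{uVar, uPred, uVal, uS} Var Pred ar) (s : M.S),
          LUD.Sat M φ s ↔ LUDPlus.Sat M ψ s)) := by
  refine ⟨fun X Y hX hY => LUD.not_exists_iff_localUniformDep ar hX hY,
    fun φ => ⟨φ.toPlus, fun M s => by rw [LUD.sat_toPlus]⟩, ?_⟩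
  obtain ⟨x, y, hxy⟩ := exists_pair_ne Var
  exact ⟨.localUnifDep {x} {y}, LUD.not_exists_iff_localUniformDep ar
    (Finset.singleton_nonempty x) (by simpa using hxy.symm)⟩
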